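/- Let $0\le b\le c<1$ with $c>0$, and let $\log$ denote the base-$2$ logarithm. Protocols. There are $n$ players and a secret $X\in\mathcal X$; $L_i\in\{0,1\}$ indicates whether player $i$ knows $X$. A collaborating cryptogenography protocol specifies, for every current transcript (finite list of messages sent so far, all of them public), whether the communication stops and, if not, which player $i$ sends the next message, a discrete distribution $p_?$ and discrete distributions $(p_x)_{x\in\mathcal X}$ on messages; player $i$ draws the message from $p_?$ if $L_i=0$ and from $p_x$ if $L_i=1$ and $X=x$ (with fresh independent randomness). The number of messages is bounded by a constant depending on the protocol. Let $T$ be the complete transcript. Let $h\ge 0$, $\epsilon>0$, and let $L=(L_1,\dots,L_n)$ have a given distribution. A risky $(n,h,L,c,\epsilon)$-protocol is a protocol together with a function $D$ from transcripts to $\mathcal X=\{1,\dots,2^{\lceil h\rceil}\}$ such that, when $X$ is uniform on $\mathcal X$ and independent of $L$, for every $x\in\mathcal X$, with probability at least $1-\epsilon$ conditionally on $X=x$, the transcript $T=t$ satisfies both $\Pr(L_i=1\mid T=t,X=x)\le c$ for all $i$ and $D(t)=x$. It is a safe $(n,h,L,c,\epsilon)$-protocol if moreover $\Pr(L_i=1\mid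 T=t,X=x)\le c$ for all $i,t,x$ with $\Pr(T=t,X=x)>0$. Let $\mathrm{Indep}_b(n)$ be $(L_1,\dots,L_n)$ with independent $L_i$ and $\Pr(L_i=1)=b$. A rate $R\ge 0$ is safely (riskily) $c$-achievable for $\mathrm{Indep}_b$ if for all $\epsilon>0$ and all $n_0$ there is a safe (risky) $(n,nR,\mathrm{Indep}_b(n),c,\epsilon)$-protocol with $n\ge n_0$. The safe (risky) $c$-capacity for $\mathrm{Indep}_b$ is the supremum of all safely (riskily) $c$-achievable rates. Statement. The safe $c$-capacity for $\mathrm{Indep}_b$ is $$\frac{-b\log(1-c)+c\log(1-b)}{c},$$ and the risky $c$-capacity for $\mathrm{Indep}_b$ is the same number. -/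

import Mathlib

open scoped BigOperators ENNReal

noncomputable section

namespace Cryptogenography

/-- The probability of the event `A` under the discrete law `p`. -/
def prob {α : Type} (p : PMF α) (A : Set α) : ℝ :=
  (p.toOuterMeasure A).toReal

/-- The conditional probability `Pr(A | B)` under the discrete law `p`; meaningful only if
`Pr(B) > 0`. -/
def condProb {α : Type} (p : PMF α) (A B : Set α) : ℝ :=
  prob p (A ∩ B) / prob p B

/-- What a protocol prescribes when the communication continues: the player who sends the next
message, the distribution `ignorant` of the message if this player does not know the secret, and
the distribution `leak x` of the message if the player knows that the secret is `x`. -/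
structure Step (n : ℕ) (X M : Type) where
  speaker : Fin n
  ignorant : PMF M
  leak : X → PMF M

/-- A collaborating cryptogenography protocol for `n` players, with secrets in `X` and messages in
`M`. A transcript is the list of the messages sent, in chronological order. The current transcript
determines whether the communication stops (`none`) or how it continues (`some _`), and the
number of messages is bounded by `length`. -/
structure Protocol (n : ℕ) (X M : Type) where
  next : List M → Option (Step n X M)
  length : ℕ
  next_eq_none : ∀ t : List M, length ≤ t.length → next t = none

namespace Protocol

variable {n : ℕ} {X M : Type}

/-- The law of the transcript after at most `k` further messages when the current transcript is
`t`, the secret is `x`, and `l i = true` iff player `i` knows the secret. -/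
def run (π : Protocol n X M) (x : X) (l : Fin n → Bool) : ℕ → List M → PMF (List M)
  | 0, t => PMF.pure t
  | k + 1, t =>
    match π.next t with
    | none => PMF.pure t
    | some s =>
      (if l s.speaker = true then s.leak x else s.ignorant).bind fun m => run π x l k (t ++ [m])

/-- The law of the complete transcript given the secret and the set of players who know it. -/
def transcriptLaw (π : Protocol n X M) (x : X) (l : Fin n → Bool) : PMF (List M) :=
  π.run x l π.length []

/-- The joint law of `(X, L, T)`, where `X` is uniform, `L` has the law `μ` and is independent of
`X`, and `T` is the complete transcript. -/
def joint [Fintype X] [Nonempty X] (π : Protocol n X M) (μ : PMF (Fin n → Bool)) :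
    PMF (X × (Fin n → Bool) × List M) :=
  (PMF.uniformOfFintype X).bind fun x =>
    μ.bind fun l => (π.transcriptLaw x l).map fun t => (x, l, t)

/-- The posterior probability `Pr(L_i = 1 | T = t, X = x)`. -/
def posterior [Fintype X] [Nonempty X] (π : Protocol n X M) (μ : PMF (Fin n → Bool))
    (i : Fin n) (t : List M) (x : X) : ℝ :=
  condProb (π.joint μ) {ω | ω.2.1 i = true} {ω | ω.2.2 = t ∧ ω.1 = x}

end Protocol

/-- The set of secrets `{1, …, 2 ^ ⌈h⌉}` (for `h ≥ 0`), indexed from `0`. -/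
abbrev Secret (h : ℝ) : Type := Fin (2 ^ ⌈h⌉₊)

/-- The protocol `π` with the guessing function `D` is a risky `(n, h, L, c, ε)`-protocol, where
`μ` is the law of `L`: for every secret `x`, with probability at least `1 - ε` given `X = x`, the
transcript `t` satisfies `Pr(L_i = 1 | T = t, X = x) ≤ c` for all `i` and `D t = x`. -/
def IsRisky {n : ℕ} {M : Type} (h : ℝ) (μ : PMF (Fin n → Bool)) (c ε : ℝ)
    (π : Protocol n (Secret h) M) (D : List M → Secret h) : Prop :=
  ∀ x : Secret h,
    1 - ε ≤ condProb (π.joint μ)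
      {ω | (∀ i, π.posterior μ i ω.2.2 x ≤ c) ∧ D ω.2.2 = x} {ω | ω.1 = x}

/-- The protocol `π` with the guessing function `D` is a safe `(n, h, L, c, ε)`-protocol: it is
risky, and `Pr(L_i = 1 | T = t, X = x) ≤ c` whenever `Pr(T = t, X = x) > 0`. -/
def IsSafe {n : ℕ} {M : Type} (h : ℝ) (μ : PMF (Fin n → Bool)) (c ε : ℝ)
    (π : Protocol n (Secret h) M) (D : List M → Secret h) : Prop :=
  IsRisky h μ c ε π D ∧
    ∀ (i : Fin n) (t : List M) (x : Secret h),
      0 < prob (π.joint μ) {ω | ω.2.2 = t ∧ ω.1 = x} → π.posterior μ i t x ≤ c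

/-- The law `Indep_b(n)` of `(L_1, …, L_n)`: independent, each `1` with probability `b`. -/
def indepLaw (b : unitInterval) (n : ℕ) : PMF (Fin n → Bool) :=
  PMF.ofFintype (fun l => ∏ i, ENNReal.ofReal (if l i = true then (b : ℝ) else 1 - b)) (by
    have h := Fintype.prod_sum (R := ℝ≥0∞)
      (fun (_ : Fin n) (v : Bool) => ENNReal.ofReal (if v = true then (b : ℝ) else 1 - b))
    rw [← h]
    refine Finset.prod_eq_one fun i _ => ?_
    rw [Fintype.sum_bool]
    simp only [if_true, Bool.false_eq_true, if_false]
    rw [← ENNReal.ofReal_add b.2.1 (sub_nonneg.2 b.2.2)]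
    simp)

/-- The rate `R ≥ 0` is safely `c`-achievable for `Indep_b`. -/
def SafelyAchievable (b : unitInterval) (c R : ℝ) : Prop :=
  0 ≤ R ∧ ∀ ε : ℝ, 0 < ε → ∀ n₀ : ℕ, ∃ n : ℕ, n₀ ≤ n ∧
    ∃ (M : Type) (π : Protocol n (Secret (n * R)) M) (D : List M → Secret (n * R)),
      IsSafe (n * R) (indepLaw b n) c ε π D

/-- The rate `R ≥ 0` is riskily `c`-achievable for `Indep_b`. -/
def RiskilyAchievable (b : unitInterval) (c R : ℝ) : Prop :=
  0 ≤ R ∧ ∀ ε : ℝ, 0 < ε → ∀ n₀ : ℕ, ∃ n : ℕ, n₀ ≤ n ∧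
    ∃ (M : Type) (π : Protocol n (Secret (n * R)) M) (D : List M → Secret (n * R)),
      IsRisky (n * R) (indepLaw b n) c ε π D

/-- `C` is the safe `c`-capacity for `Indep_b`: the supremum of the safely achievable rates. -/
def IsSafeCapacity (b : unitInterval) (c C : ℝ) : Prop :=
  IsLUB {R : ℝ | SafelyAchievable b c R} C

/-- `C` is the risky `c`-capacity for `Indep_b`: the supremum of the riskily achievable rates. -/
def IsRiskyCapacity (b : unitInterval) (c C : ℝ) : Prop :=
  IsLUB {R : ℝ | RiskilyAchievable b c R} C

end Cryptogenography

end

open scoped BigOperators ENNReal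

noncomputable section

namespace Cryptogenography

/-! ### Conditioning on the secret. -/

namespace Protocol

variable {n : ℕ} {X M : Type}

/-! Converse. Given the transcript `t`, the players' knowledge enters its probability only through a
product of one factor per player (`exists_run_eq_prod`). With an independent prior, the law `Q` of
the transcript when nobody knows the secret therefore satisfies `Q t * (1 - b) ^ n = P_x t * ∏ (1 -
p_i)`, where `P_x` is the law given `x` and `p_i` are the posteriors. If every `p_i ≤ c`, convexity
bounds the product below by `exp (-κ ∑ p_i)` with `κ = -log (1 - c) / c`, and the posteriors average
to `b`. So `Q` gives each set of good transcripts decoded to `x` mass at least about `exp (-n (κ b +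
log (1 - b)))` (`exp_mul_le_prob_ignorant`). These sets are disjoint and `Q` does not depend on `x`,
so there cannot be too many secrets (`card_mul_exp_le_one`).

Achievability. Each player speaks once, tossing one coin of bias `a` per candidate secret; an
informed player forces success at the true one. This multiplies the odds of being informed by at
most `1 / a`, and `a` is chosen so that they never exceed `c / (1 - c)`. Decoding compares
log-likelihood scores. The mean score per message of the true secret is the capacity in nats, and
Chernoff and union bounds finish (`one_sub_le_prob_tossProtocol`, `safelyAchievable_of_lt`).

Safe implies risky, so these two bounds settle both capacities. -/

/-- The law of the complete transcript given the secret. -/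
def lawGiven (π : Protocol n X M) (μ : PMF (Fin n → Bool)) (x : X) : PMF (List M) :=
  μ.bind fun l => π.transcriptLaw x l

/-- The probability, given the secret `x`, that player `i` knows it and the transcript is `t`. -/
def knowMass (π : Protocol n X M) (μ : PMF (Fin n → Bool)) (x : X) (i : Fin n) (t : List M) :
    ℝ≥0∞ :=
  ∑ l, if l i = true then μ l * π.transcriptLaw x l t else 0

theorem lawGiven_apply (π : Protocol n X M) (μ : PMF (Fin n → Bool)) (x : X) (t : List M) :
    π.lawGiven μ x t = ∑ l, μ l * π.transcriptLaw x l t := by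
  rw [lawGiven, PMF.bind_apply, tsum_fintype]

theorem knowMass_le_lawGiven (π : Protocol n X M) (μ : PMF (Fin n → Bool)) (x : X) (i : Fin n)
    (t : List M) : π.knowMass μ x i t ≤ π.lawGiven μ x t := by
  rw [lawGiven_apply, knowMass]
  refine Finset.sum_le_sum fun l _ => ?_
  split_ifs <;> simp

theorem tsum_knowMass (π : Protocol n X M) (μ : PMF (Fin n → Bool)) (x : X) (i : Fin n) :
    ∑' t, π.knowMass μ x i t = ∑ l, if l i = true then μ l else 0 := by
  simp only [knowMass]
  rw [Summable.tsum_finsetSum (fun _ _ => ENNReal.summable)]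
  refine Finset.sum_congr rfl fun l _ => ?_
  split_ifs
  · rw [ENNReal.tsum_mul_left, PMF.tsum_coe, mul_one]
  · simp

theorem toOuterMeasure_joint [Fintype X] [Nonempty X] (π : Protocol n X M)
    (μ : PMF (Fin n → Bool)) (S : Set (X × (Fin n → Bool) × List M)) :
    (π.joint μ).toOuterMeasure S = ∑ x, (Fintype.card X : ℝ≥0∞)⁻¹ *
      ∑ l, μ l * (π.transcriptLaw x l).toOuterMeasure {t | (x, l, t) ∈ S} := by
  rw [joint, PMF.toOuterMeasure_bind_apply, tsum_fintype]
  refine Finset.sum_congr rfl fun x _ => ?_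
  rw [PMF.uniformOfFintype_apply, PMF.toOuterMeasure_bind_apply, tsum_fintype]
  congr 1
  refine Finset.sum_congr rfl fun l _ => ?_
  rw [PMF.toOuterMeasure_map_apply]
  rfl

theorem toOuterMeasure_joint_inter [Fintype X] [Nonempty X] (π : Protocol n X M)
    (μ : PMF (Fin n → Bool)) (S : Set (X × (Fin n → Bool) × List M)) (x : X) :
    (π.joint μ).toOuterMeasure (S ∩ {ω | ω.1 = x}) = (Fintype.card X : ℝ≥0∞)⁻¹ *
      ∑ l, μ l * (π.transcriptLaw x l).toOuterMeasure {t | (x, l, t) ∈ S} := by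
  rw [toOuterMeasure_joint, Finset.sum_eq_single x]
  · simp
  · intro y _ hy
    simp [hy]
  · simp

/-- The uniform weight of `x` cancels, so the success condition becomes one about `lawGiven` alone.
-/
theorem condProb_joint_transcript [Fintype X] [Nonempty X] (π : Protocol n X M)
    (μ : PMF (Fin n → Bool)) (G : Set (List M)) (x : X) :
    condProb (π.joint μ) {ω | ω.2.2 ∈ G} {ω | ω.1 = x} = prob (π.lawGiven μ x) G := by
  have hX : ((Fintype.card X : ℝ≥0∞)⁻¹).toReal ≠ 0 := by simp
  have h1 : (π.joint μ).toOuterMeasure {ω | ω.1 = x} = (Fintype.card X : ℝ≥0∞)⁻¹ := by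
    have := toOuterMeasure_joint_inter π μ Set.univ x
    rw [Set.univ_inter] at this
    rw [this]
    have h : ∀ l, (π.transcriptLaw x l).toOuterMeasure {t | (x, l, t) ∈ Set.univ} = 1 := by
      intro l
      rw [PMF.toOuterMeasure_apply_eq_one_iff]
      intro t _
      trivial
    simp only [h, mul_one]
    rw [← tsum_fintype (L := .unconditional _), PMF.tsum_coe, mul_one]
  rw [condProb, prob, prob, prob, toOuterMeasure_joint_inter, h1, ENNReal.toReal_mul,
    mul_div_cancel_left₀ _ hX, lawGiven, PMF.toOuterMeasure_bind_apply, tsum_fintype]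
  rfl

theorem posterior_eq [Fintype X] [Nonempty X] (π : Protocol n X M)
    (μ : PMF (Fin n → Bool)) (i : Fin n) (t : List M) (x : X) :
    π.posterior μ i t x = (π.knowMass μ x i t).toReal / (π.lawGiven μ x t).toReal := by
  have hX : ((Fintype.card X : ℝ≥0∞)⁻¹).toReal ≠ 0 := by simp
  have e1 : ({ω | ω.2.2 = t ∧ ω.1 = x} : Set (X × (Fin n → Bool) × List M)) =
    {ω | ω.2.2 = t} ∩ {ω | ω.1 = x} := rfl
  rw [posterior, condProb, prob, prob, e1, ← Set.inter_assoc, toOuterMeasure_joint_inter,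
    toOuterMeasure_joint_inter, ENNReal.toReal_mul, ENNReal.toReal_mul,
    mul_div_mul_left _ _ hX, lawGiven_apply, knowMass]
  congr 2
  · refine Finset.sum_congr rfl fun l _ => ?_
    by_cases h : l i = true
    · have : {s | (x, l, s) ∈ ({ω | ω.2.1 i = true} ∩ {ω | ω.2.2 = t} :
          Set (X × (Fin n → Bool) × List M))} = {t} := by
        ext s; simp [h]
      rw [if_pos h, this, PMF.toOuterMeasure_apply_singleton]
    · have : {s | (x, l, s) ∈ ({ω | ω.2.1 i = true} ∩ {ω | ω.2.2 = t} :
          Set (X × (Fin n → Bool) × List M))} = ∅ := by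
        ext s; simp [h]
      rw [if_neg h, this]
      simp
  · refine Finset.sum_congr rfl fun l _ => ?_
    have : {s | (x, l, s) ∈ ({ω | ω.2.2 = t} :
          Set (X × (Fin n → Bool) × List M))} = {t} := by
      ext s; simp
    rw [this, PMF.toOuterMeasure_apply_singleton]

/-! ### Transcript probabilities factor over the players. -/

theorem prefix_of_run_ne_zero (π : Protocol n X M) (x : X) (l : Fin n → Bool) (k : ℕ)
    (t₀ t : List M) (h : π.run x l k t₀ t ≠ 0) : t₀ <+: t := by
  induction k generalizing t₀ with
  | zero =>
    rw [run, PMF.pure_apply] at h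
    have : t = t₀ := by by_contra h'; simp [h'] at h
    rw [this]
  | succ k ih =>
    rw [run] at h
    split at h
    · rw [PMF.pure_apply] at h
      have : t = t₀ := by by_contra h'; simp [h'] at h
      rw [this]
    · rw [PMF.bind_apply] at h
      have : ∃ m, π.run x l k (t₀ ++ [m]) t ≠ 0 := by
        by_contra! h'
        simp [h'] at h
      obtain ⟨m, hm⟩ := this
      exact (List.prefix_append t₀ [m]).trans (ih _ hm)

/-- The law of the next message of a player whose knowledge is `o`. -/
def _root_.Cryptogenography.Step.messageLaw (s : Step n X M) : Option X → PMF M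
  | none => s.ignorant
  | some x => s.leak x

/-- What a player knows about the secret `x`. -/
def _root_.Cryptogenography.knowledge (x : X) (v : Bool) : Option X :=
  if v = true then some x else none

theorem _root_.Cryptogenography.Step.messageLaw_knowledge (s : Step n X M) (x : X) (v : Bool) :
    s.messageLaw (knowledge x v) = if v = true then s.leak x else s.ignorant := by
  cases v <;> rfl

/-- Transcripts only grow, so the target `t` dictates the next message and the sum over messages has
a single nonzero term. -/
theorem run_succ_of_prefix (π : Protocol n X M) {s : Step n X M} {k : ℕ} {t₀ t : List M}
    (hs : π.next t₀ = some s) {m : M} (hm : t₀ ++ [m] <+: t) (x : X) (l : Fin n → Bool) :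
    π.run x l (k + 1) t₀ t =
      s.messageLaw (knowledge x (l s.speaker)) m * π.run x l k (t₀ ++ [m]) t := by
  rw [run, hs, Step.messageLaw_knowledge]
  simp only [PMF.bind_apply]
  refine tsum_eq_single m fun m' hm' => ?_
  have : π.run x l k (t₀ ++ [m']) t = 0 := by
    by_contra h
    have h' := prefix_of_run_ne_zero π x l k _ t h
    have := List.prefix_of_prefix_length_le h' hm (by simp)
    have := this.eq_of_length (by simp)
    simp at this
    exact hm' this
  rw [this, mul_zero]

theorem run_succ_of_not_prefix (π : Protocol n X M) {s : Step n X M} {k : ℕ} {t₀ t : List M}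
    (hs : π.next t₀ = some s) (hm : ∀ m, ¬ t₀ ++ [m] <+: t) (x : X) (l : Fin n → Bool) :
    π.run x l (k + 1) t₀ t = 0 := by
  rw [run, hs]
  simp only [PMF.bind_apply]
  rw [ENNReal.tsum_eq_zero]
  intro m
  have : π.run x l k (t₀ ++ [m]) t = 0 := by
    by_contra h
    exact hm m (prefix_of_run_ne_zero π x l k _ t h)
  rw [this, mul_zero]

/-- The probability of a transcript is a product of contributions of the individual players, each
depending only on what the player knows. -/
theorem exists_run_eq_prod (π : Protocol n X M) (k : ℕ) (t₀ t : List M) :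
    ∃ (e : ℝ) (q : Fin n → Option X → ℝ), 0 ≤ e ∧ (∀ i o, 0 ≤ q i o) ∧
      ∀ x l, (π.run x l k t₀ t).toReal = e * ∏ i, q i (knowledge x (l i)) := by
  classical
  induction k generalizing t₀ with
  | zero =>
    exact ⟨if t = t₀ then 1 else 0, fun _ _ => 1, by split_ifs <;> simp, by simp, fun x l => by
      rw [run, PMF.pure_apply]; split_ifs <;> simp⟩
  | succ k ih =>
    cases hs : π.next t₀ with
    | none =>
      exact ⟨if t = t₀ then 1 else 0, fun _ _ => 1, by split_ifs <;> simp, by simp, fun x l => by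
        rw [run, hs]; simp only [PMF.pure_apply]; split_ifs <;> simp⟩
    | some s =>
      by_cases h : ∃ m, t₀ ++ [m] <+: t
      · obtain ⟨m, hm⟩ := h
        obtain ⟨e, q, he, hq, H⟩ := ih (t₀ ++ [m])
        -- Only the speaker's factor is updated. It sees the secret through `Option X`, so `q i
        -- none` is the same for all secrets.
        refine ⟨e, fun i o => (if i = s.speaker then (s.messageLaw o m).toReal else 1) * q i o,
          he, fun i o => ?_, fun x l => ?_⟩
        · have := hq i o
          dsimp only
          split_ifs <;> positivity
        · rw [run_succ_of_prefix π hs hm, ENNReal.toReal_mul, H, Finset.prod_mul_distrib,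
            Finset.prod_ite_eq' Finset.univ s.speaker, if_pos (Finset.mem_univ _)]
          ring
      · push Not at h
        exact ⟨0, fun _ _ => 1, le_rfl, by simp, fun x l => by
          rw [run_succ_of_not_prefix π hs h]; simp⟩

end Protocol

/-! ### Averaging over independent knowledge. -/

theorem toReal_indepLaw (b : unitInterval) (n : ℕ) (l : Fin n → Bool) :
    (indepLaw b n l).toReal = ∏ i, if l i = true then (b : ℝ) else 1 - b := by
  rw [indepLaw, PMF.ofFintype_apply, ENNReal.toReal_prod]
  refine Finset.prod_congr rfl fun i _ => ENNReal.toReal_ofReal ?_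
  split_ifs
  exacts [b.2.1, sub_nonneg.2 b.2.2]

theorem sum_indepLaw_mul_prod (b : unitInterval) (n : ℕ) (f : Fin n → Bool → ℝ) :
    ∑ l, (indepLaw b n l).toReal * ∏ i, f i (l i) =
      ∏ i, ((b : ℝ) * f i true + (1 - b) * f i false) := by
  simp only [toReal_indepLaw, ← Finset.prod_mul_distrib]
  rw [← Fintype.prod_sum (fun i (v : Bool) => (if v = true then (b : ℝ) else 1 - b) * f i v)]
  simp

/-- The indicator that player `i` is informed is absorbed into the `i`-th factor. -/
theorem sum_indepLaw_mul_prod_of_true (b : unitInterval) (n : ℕ) (f : Fin n → Bool → ℝ)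
    (i : Fin n) :
    ∑ l, (if l i = true then (indepLaw b n l).toReal * ∏ j, f j (l j) else 0) =
      (b : ℝ) * f i true *
        ∏ j ∈ Finset.univ.erase i, ((b : ℝ) * f j true + (1 - b) * f j false) := by
  have h := sum_indepLaw_mul_prod b n fun j v => (if j = i then (if v = true then 1 else 0) else 1) *
    f j v
  simp only [Finset.prod_mul_distrib, Finset.prod_ite_eq', Finset.mem_univ, if_true] at h
  rw [← Finset.mul_prod_erase _ _ (Finset.mem_univ i)] at h
  convert h using 1
  · refine Finset.sum_congr rfl fun l _ => ?_
    split_ifs <;> simp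
  · congr 1
    · simp
    · refine Finset.prod_congr rfl fun j hj => ?_
      simp [Finset.ne_of_mem_erase hj]

namespace Protocol

variable {n : ℕ} {X M : Type}

theorem toReal_lawGiven_indepLaw (π : Protocol n X M) (b : unitInterval) {t : List M} {e : ℝ}
    {q : Fin n → Option X → ℝ}
    (H : ∀ x l, (π.transcriptLaw x l t).toReal = e * ∏ i, q i (knowledge x (l i))) (x : X) :
    (π.lawGiven (indepLaw b n) x t).toReal =
      e * ∏ i, ((b : ℝ) * q i (some x) + (1 - b) * q i none) := by
  rw [lawGiven_apply, ENNReal.toReal_sum fun l _ =>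
    ENNReal.mul_ne_top (PMF.apply_ne_top _ _) (PMF.apply_ne_top _ _)]
  have h := sum_indepLaw_mul_prod b n fun i v => q i (knowledge x v)
  simp only [knowledge, if_true, Bool.false_eq_true, if_false] at h
  rw [← h, Finset.mul_sum]
  refine Finset.sum_congr rfl fun l _ => ?_
  rw [ENNReal.toReal_mul, H]
  simp only [knowledge]
  ring

theorem toReal_knowMass_indepLaw (π : Protocol n X M) (b : unitInterval) {t : List M} {e : ℝ}
    {q : Fin n → Option X → ℝ}
    (H : ∀ x l, (π.transcriptLaw x l t).toReal = e * ∏ i, q i (knowledge x (l i))) (x : X)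
    (i : Fin n) :
    (π.knowMass (indepLaw b n) x i t).toReal = e * ((b : ℝ) * q i (some x) *
      ∏ j ∈ Finset.univ.erase i, ((b : ℝ) * q j (some x) + (1 - b) * q j none)) := by
  rw [knowMass, ENNReal.toReal_sum fun l _ => by
    split_ifs
    exacts [ENNReal.mul_ne_top (PMF.apply_ne_top _ _) (PMF.apply_ne_top _ _), ENNReal.zero_ne_top]]
  have h := sum_indepLaw_mul_prod_of_true b n (fun i v => q i (knowledge x v)) i
  simp only [knowledge, if_true, Bool.false_eq_true, if_false] at h
  rw [← h, Finset.mul_sum]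
  refine Finset.sum_congr rfl fun l _ => ?_
  split_ifs
  · rw [ENNReal.toReal_mul, H]
    simp only [knowledge]
    ring
  · simp

/-- Posteriors average to the prior: this is the budget that the converse spends. -/
theorem tsum_toReal_knowMass_indepLaw (π : Protocol n X M) (b : unitInterval) (x : X)
    (i : Fin n) : ∑' t, (π.knowMass (indepLaw b n) x i t).toReal = b := by
  rw [← ENNReal.tsum_toReal_eq fun t => ne_top_of_le_ne_top (PMF.apply_ne_top _ _)
    (knowMass_le_lawGiven π _ x i t), tsum_knowMass,
    ENNReal.toReal_sum fun l _ => by split_ifs; exacts [PMF.apply_ne_top _ _, ENNReal.zero_ne_top]]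
  have h := sum_indepLaw_mul_prod_of_true b n (fun _ _ => 1) i
  simp only [Finset.prod_const_one, mul_one, add_sub_cancel] at h
  rw [← h]
  exact Finset.sum_congr rfl fun l _ => by split_ifs <;> rfl

end Protocol

/-! ### The converse bound. -/

theorem summable_toReal {α : Type} (p : PMF α) : Summable fun a => (p a).toReal :=
  ENNReal.summable_toReal p.tsum_coe_ne_top

theorem prob_eq_tsum_indicator {α : Type} (p : PMF α) (A : Set α) :
    prob p A = ∑' a, A.indicator (fun a => (p a).toReal) a := by
  rw [prob, PMF.toOuterMeasure_apply, ENNReal.tsum_toReal_eq]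
  · refine tsum_congr fun a => ?_
    by_cases h : a ∈ A <;> simp [h]
  · intro a
    by_cases h : a ∈ A <;> simp [h, PMF.apply_ne_top]

/-- The convex exponential lies below its chord over `[log (1 - c), 0]`; equality at `p = 0` and `p
= c` fixes the constant. -/
theorem exp_neg_mul_le_one_sub {c p : ℝ} (hc0 : 0 < c) (hc1 : c < 1) (hp0 : 0 ≤ p) (hpc : p ≤ c) :
    Real.exp (-(-Real.log (1 - c) / c * p)) ≤ 1 - p := by
  have h := convexOn_exp.2 (Set.mem_univ (0 : ℝ)) (Set.mem_univ (Real.log (1 - c)))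
    (sub_nonneg.2 ((div_le_one hc0).2 hpc)) (div_nonneg hp0 hc0.le) (by ring)
  simp only [smul_eq_mul, mul_zero, zero_add, Real.exp_zero, mul_one,
    Real.exp_log (sub_pos.2 hc1)] at h
  calc Real.exp (-(-Real.log (1 - c) / c * p)) = Real.exp (p / c * Real.log (1 - c)) := by
        congr 1; ring
    _ ≤ 1 - p / c + p / c * (1 - c) := h
    _ = 1 - p := by field_simp; ring

namespace Protocol

variable {n : ℕ} {X M : Type}

/-- With nobody informed, `leak` is never consulted. This supplies one reference law for all
secrets. -/
theorem transcriptLaw_ignorant (π : Protocol n X M) (x y : X) :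
    π.transcriptLaw x (fun _ => false) = π.transcriptLaw y (fun _ => false) := by
  have h : ∀ k t, π.run x (fun _ => false) k t = π.run y (fun _ => false) k t := by
    intro k
    induction k with
    | zero => intro t; rfl
    | succ k ih =>
      intro t
      rw [run, run]
      cases π.next t with
      | none => rfl
      | some s => simp [ih]
  exact h _ _

/-- Where all posteriors are at most `c`, the probability of a transcript when nobody knows the
secret is not much smaller than its probability given the secret. -/
theorem exp_mul_le_ignorant [Fintype X] [Nonempty X] (π : Protocol n X M) (b : unitInterval)
    {c : ℝ} (hbc : (b : ℝ) ≤ c) (hc0 : 0 < c) (hc1 : c < 1) (x : X) (t : List M)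
    (ht : ∀ i, π.posterior (indepLaw b n) i t x ≤ c) (a : ℝ) :
    Real.exp (-(a + n * Real.log (1 - b))) *
      ((π.lawGiven (indepLaw b n) x t).toReal * (1 + a) - -Real.log (1 - c) / c *
        ∑ i, (π.knowMass (indepLaw b n) x i t).toReal) ≤
      (π.transcriptLaw x (fun _ => false) t).toReal := by
  obtain ⟨e, q, he, hq, H⟩ := π.exists_run_eq_prod π.length [] t
  have hb : 0 < 1 - (b : ℝ) := by linarith
  have hb0 : 0 ≤ (b : ℝ) := b.2.1
  have hP := π.toReal_lawGiven_indepLaw b H x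
  have hN := π.toReal_knowMass_indepLaw b H x
  have hQ := H x fun _ => false
  change (π.transcriptLaw x (fun _ => false) t).toReal = _ at hQ
  simp only [posterior_eq] at ht
  simp only [knowledge, Bool.false_eq_true, if_false] at hQ
  set P := (π.lawGiven (indepLaw b n) x t).toReal with hPdef
  set N := fun i => (π.knowMass (indepLaw b n) x i t).toReal with hNdef
  change ∀ i, N i = _ at hN
  change ∀ i, N i / P ≤ c at ht
  change _ * (_ - _ * ∑ i, N i) ≤ _
  have hNP : ∀ i, N i ≤ P := fun i => ENNReal.toReal_mono (PMF.apply_ne_top _ _)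
    (knowMass_le_lawGiven π _ x i t)
  have hN0 : ∀ i, 0 ≤ N i := fun i => ENNReal.toReal_nonneg
  have hP0 : 0 ≤ P := ENNReal.toReal_nonneg
  rcases hP0.eq_or_lt with h0 | hpos
  · have : ∀ i, N i = 0 := fun i => le_antisymm (h0 ▸ hNP i) (hN0 i)
    simp [← h0, this]
  set r := fun i => (b : ℝ) * q i (some x) + (1 - b) * q i none with hr
  change P = e * ∏ i, r i at hP
  have hr0 : ∀ i, r i ≠ 0 := fun i h => by
    rw [hP, Finset.prod_eq_zero (Finset.mem_univ i) h] at hpos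
    simp at hpos
  -- `N i / P` is the posterior of player `i`; the factors of the other players cancel in it.
  have hfac : ∀ i, 1 - N i / P = (1 - b) * q i none / r i := by
    intro i
    have h1 : P = r i * (e * ∏ j ∈ Finset.univ.erase i, r j) := by
      rw [hP, ← Finset.mul_prod_erase _ r (Finset.mem_univ i)]; ring
    have h2 : N i = b * q i (some x) * (e * ∏ j ∈ Finset.univ.erase i, r j) := by
      rw [hN]; ring
    have h3 : e * ∏ j ∈ Finset.univ.erase i, r j ≠ 0 := fun h => by
      rw [h1, h, mul_zero] at hpos
      exact lt_irrefl _ hpos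
    rw [h1, h2, mul_div_mul_right _ _ h3, eq_div_iff (hr0 i), sub_mul, div_mul_cancel₀ _ (hr0 i)]
    simp only [hr]; ring
  have hQP : (π.transcriptLaw x (fun _ => false) t).toReal * (1 - b) ^ n =
      P * ∏ i, (1 - N i / P) := by
    simp only [hfac]
    rw [Finset.prod_div_distrib, Finset.prod_mul_distrib, hQ, hP, Finset.prod_const,
      Finset.card_univ, Fintype.card_fin]
    have : ∏ i, r i ≠ 0 := Finset.prod_ne_zero_iff.2 fun i _ => hr0 i
    field_simp
  have hprod : Real.exp (-(-Real.log (1 - c) / c * ∑ i, N i / P)) ≤ ∏ i, (1 - N i / P) := by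
    rw [Finset.mul_sum, ← Finset.sum_neg_distrib, Real.exp_sum]
    exact Finset.prod_le_prod (fun i _ => (Real.exp_pos _).le) fun i _ =>
      exp_neg_mul_le_one_sub hc0 hc1 (div_nonneg (hN0 i) hP0) (ht i)
  -- A tangent line replaces Jensen's inequality: after multiplication by `P` the bound is linear in
  -- `P` and `N`, so it can be summed over transcripts. The free parameter `a` is the point of
  -- tangency.
  have hexp := Real.add_one_le_exp (a - -Real.log (1 - c) / c * ∑ i, N i / P)
  have hpow : Real.exp (n * Real.log (1 - b)) = (1 - (b : ℝ)) ^ n := by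
    rw [mul_comm, Real.exp_mul, Real.exp_log hb, Real.rpow_natCast]
  have hpow' : 0 < (1 - (b : ℝ)) ^ n := pow_pos hb n
  rw [neg_add, Real.exp_add, Real.exp_neg (n * Real.log (1 - b)), hpow]
  refine le_of_mul_le_mul_right ?_ hpow'
  rw [hQP]
  calc Real.exp (-a) * ((1 - (b : ℝ)) ^ n)⁻¹ *
        (P * (1 + a) - -Real.log (1 - c) / c * ∑ i, N i) * (1 - b) ^ n
      = P * (Real.exp (-a) * (a - -Real.log (1 - c) / c * ∑ i, N i / P + 1)) := by
        rw [← Finset.sum_div]; field_simp; ring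
    _ ≤ P * (Real.exp (-a) * Real.exp (a - -Real.log (1 - c) / c * ∑ i, N i / P)) := by gcongr
    _ = P * Real.exp (-(-Real.log (1 - c) / c * ∑ i, N i / P)) := by
        rw [← Real.exp_add]; congr 2; ring
    _ ≤ _ := by gcongr

theorem exp_mul_le_prob_ignorant [Fintype X] [Nonempty X] (π : Protocol n X M) (b : unitInterval)
    {c ε : ℝ} (hbc : (b : ℝ) ≤ c) (hc0 : 0 < c) (hc1 : c < 1) (hε : ε < 1) (x : X)
    (G : Set (List M)) (hG : ∀ t ∈ G, ∀ i, π.posterior (indepLaw b n) i t x ≤ c)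
    (hPG : 1 - ε ≤ prob (π.lawGiven (indepLaw b n) x) G) :
    Real.exp (-(n * (-Real.log (1 - c) / c * b / (1 - ε) + Real.log (1 - b)))) * (1 - ε) ≤
      prob (π.transcriptLaw x fun _ => false) G := by
  set κ := -Real.log (1 - c) / c with hκdef
  have hκ : 0 ≤ κ := div_nonneg (neg_nonneg.2 (Real.log_nonpos (by linarith) (by linarith))) hc0.le
  have hb0 : 0 ≤ (b : ℝ) := b.2.1
  -- With this choice `κ * (n * b) = (1 - ε) * a`, so the terms in `a` contribute a nonnegative
  -- amount once `G` has mass at least `1 - ε`.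
  set a := n * (κ * b / (1 - ε)) with ha
  have hε' : 0 < 1 - ε := sub_pos.2 hε
  have ha0 : 0 ≤ a := by positivity
  set μ := indepLaw b n
  have hNP : ∀ i t, (π.knowMass μ x i t).toReal ≤ (π.lawGiven μ x t).toReal := fun i t =>
    ENNReal.toReal_mono (PMF.apply_ne_top _ _) (knowMass_le_lawGiven π _ x i t)
  have hNs : ∀ i, Summable fun t => (π.knowMass μ x i t).toReal := fun i =>
    Summable.of_nonneg_of_le (fun _ => ENNReal.toReal_nonneg) (hNP i) (summable_toReal _)
  have hsum : Summable fun t => ∑ i, (π.knowMass μ x i t).toReal :=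
    summable_sum fun i _ => hNs i
  have hNsum : ∑' t, ∑ i, (π.knowMass μ x i t).toReal = n * b := by
    rw [Summable.tsum_finsetSum fun i _ => hNs i]
    simp [μ, tsum_toReal_knowMass_indepLaw]
  have hPs := (summable_toReal (π.lawGiven μ x)).indicator G
  have hQs := (summable_toReal (π.transcriptLaw x fun _ => false)).indicator G
  have key : Real.exp (-(a + n * Real.log (1 - b))) *
      (prob (π.lawGiven μ x) G * (1 + a) - κ * (n * b)) ≤
      prob (π.transcriptLaw x fun _ => false) G := by
    rw [prob_eq_tsum_indicator, prob_eq_tsum_indicator, ← hNsum, ← tsum_mul_right,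
      ← tsum_mul_left, ← (hPs.mul_right _).tsum_sub (hsum.mul_left _), ← tsum_mul_left]
    refine Summable.tsum_le_tsum (fun t => ?_)
      (((hPs.mul_right _).sub (hsum.mul_left _)).mul_left _) hQs
    -- Off `G` the left side is nonpositive, so `knowMass` may be summed over all transcripts, where
    -- its total is known.
    by_cases ht : t ∈ G
    · simp only [Set.indicator_of_mem ht]
      exact exp_mul_le_ignorant π b hbc hc0 hc1 x t (hG t ht) a
    · simp only [Set.indicator_of_notMem ht, zero_mul, zero_sub]
      have : 0 ≤ κ * ∑ i, (π.knowMass μ x i t).toReal :=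
        mul_nonneg hκ (Finset.sum_nonneg fun _ _ => ENNReal.toReal_nonneg)
      have := Real.exp_pos (-(a + n * Real.log (1 - b)))
      nlinarith
  refine le_trans ?_ key
  rw [mul_add, ← ha]
  refine mul_le_mul_of_nonneg_left ?_ (Real.exp_pos _).le
  have h1 : κ * (n * b) = (1 - ε) * a := by rw [ha]; field_simp
  rw [h1]
  nlinarith

/-- The fibres of `D` are disjoint, so their masses under the common ignorant law add up to at most
one. -/
theorem card_mul_exp_le_one [Fintype X] [Nonempty X] (π : Protocol n X M) (b : unitInterval)
    {c ε : ℝ} (hbc : (b : ℝ) ≤ c) (hc0 : 0 < c) (hc1 : c < 1) (hε : ε < 1) (D : List M → X)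
    (h : ∀ x, 1 - ε ≤ prob (π.lawGiven (indepLaw b n) x)
      {t | (∀ i, π.posterior (indepLaw b n) i t x ≤ c) ∧ D t = x}) :
    Fintype.card X * (Real.exp (-(n * (-Real.log (1 - c) / c * b / (1 - ε) +
      Real.log (1 - b)))) * (1 - ε)) ≤ 1 := by
  classical
  have hX : Nonempty X := inferInstance
  obtain ⟨x₀⟩ := hX
  set p := π.transcriptLaw x₀ fun _ => false
  have hs : ∀ x, Summable fun t => if D t = x then (p t).toReal else 0 := fun x =>
    (summable_toReal p).indicator {t | D t = x}
  have h1 : ∀ x, Real.exp (-(n * (-Real.log (1 - c) / c * b / (1 - ε) + Real.log (1 - b)))) *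
      (1 - ε) ≤ ∑' t, if D t = x then (p t).toReal else 0 := by
    intro x
    refine (exp_mul_le_prob_ignorant π b hbc hc0 hc1 hε x _ (fun t ht => ht.1) (h x)).trans ?_
    rw [transcriptLaw_ignorant π x x₀, prob_eq_tsum_indicator]
    refine Summable.tsum_le_tsum (fun t => ?_) ((summable_toReal p).indicator _) (hs x)
    rw [Set.indicator_apply]
    simp only [Set.mem_ofPred_eq]
    split_ifs with h1 h2 h2
    · rfl
    · exact absurd h1.2 h2
    · exact ENNReal.toReal_nonneg
    · rfl
  have h2 := Finset.sum_le_sum fun x (_ : x ∈ Finset.univ) => h1 x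
  rw [Finset.sum_const, Finset.card_univ, nsmul_eq_mul] at h2
  refine h2.trans_eq ?_
  rw [← Summable.tsum_finsetSum fun x _ => hs x]
  simp only [Finset.sum_ite_eq, Finset.mem_univ, if_true]
  rw [← ENNReal.tsum_toReal_eq fun t => PMF.apply_ne_top _ _, PMF.tsum_coe, ENNReal.toReal_one]

end Protocol

open Filter Topology in
theorem rate_le_of_riskilyAchievable (b : unitInterval) {c R : ℝ} (hbc : (b : ℝ) ≤ c) (hc0 : 0 < c)
    (hc1 : c < 1) (hR : RiskilyAchievable b c R) :
    R ≤ (-(b : ℝ) * Real.logb 2 (1 - c) + c * Real.logb 2 (1 - (b : ℝ))) / c := by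
  have hlog2 : 0 < Real.log 2 := Real.log_pos one_lt_two
  have hC : (-(b : ℝ) * Real.logb 2 (1 - c) + c * Real.logb 2 (1 - (b : ℝ))) / c =
      (-Real.log (1 - c) / c * b / (1 - 0) + Real.log (1 - b)) / Real.log 2 := by
    simp only [Real.logb]; field_simp; ring
  rw [hC, le_div_iff₀ hlog2]
  have hcont : Tendsto (fun ε : ℝ => -Real.log (1 - c) / c * b / (1 - ε) + Real.log (1 - b))
      (𝓝[>] 0) (𝓝 (-Real.log (1 - c) / c * b / (1 - 0) + Real.log (1 - b))) := by
    refine (ContinuousAt.tendsto ?_).mono_left nhdsWithin_le_nhds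
    fun_prop (disch := norm_num)
  refine ge_of_tendsto hcont ?_
  filter_upwards [Ioo_mem_nhdsGT (show (0 : ℝ) < 1 by norm_num)] with ε hε
  set a := -Real.log (1 - c) / c * b / (1 - ε) + Real.log (1 - b)
  by_contra! hlt
  have hε1 : 0 < 1 - ε := sub_pos.2 hε.2
  -- Beyond this `n₀` the linear gap `n * (R * log 2 - a)` outweighs the constant loss `-log (1 -
  -- ε)`.
  obtain ⟨n₀, hn₀⟩ := exists_nat_gt (-Real.log (1 - ε) / (R * Real.log 2 - a))
  obtain ⟨n, hn, M, π, D, hπ⟩ := hR.2 ε hε.1 n₀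
  have h := π.card_mul_exp_le_one b hbc hc0 hc1 hε.2 D fun x =>
    (hπ x).trans_eq (π.condProb_joint_transcript _ {t | (∀ i, π.posterior (indepLaw b n) i t x ≤ c)
      ∧ D t = x} x)
  change _ * (Real.exp (-(n * a)) * _) ≤ 1 at h
  rw [Fintype.card_fin, Nat.cast_pow] at h
  have h' := Real.log_le_log (by positivity) h
  rw [Real.log_one, Real.log_mul (by positivity) (by positivity),
    Real.log_mul (by positivity) (by positivity), Real.log_exp, Real.log_pow] at h'
  have hceil : n * R ≤ (⌈n * R⌉₊ : ℝ) := Nat.le_ceil _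
  have hpos : 0 < R * Real.log 2 - a := sub_pos.2 hlt
  have h3 : -Real.log (1 - ε) < n * (R * Real.log 2 - a) := by
    rw [div_lt_iff₀ hpos] at hn₀
    refine hn₀.trans_le ?_
    gcongr
  push_cast at h'
  nlinarith [mul_le_mul_of_nonneg_right hceil hlog2.le]

/-! ### Biased coins and planted successes. -/

/-- The weights of a biased coin. -/
def coin (a : unitInterval) (v : Bool) : ℝ≥0∞ :=
  ENNReal.ofReal (if v = true then (a : ℝ) else 1 - a)

theorem coin_add (a : unitInterval) : coin a true + coin a false = 1 := by
  simp only [coin, if_true, Bool.false_eq_true, if_false]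
  rw [← ENNReal.ofReal_add a.2.1 (sub_nonneg.2 a.2.2)]
  simp

/-- Independent tosses of coins with biases `a i`. -/
def productLaw {N : ℕ} (a : Fin N → unitInterval) : PMF (Fin N → Bool) :=
  PMF.ofFintype (fun m => ∏ i, coin (a i) (m i)) (by
    rw [← Fintype.prod_sum (fun i v => coin (a i) v)]
    exact Finset.prod_eq_one fun i _ => by rw [Fintype.sum_bool, coin_add])

theorem productLaw_apply {N : ℕ} (a : Fin N → unitInterval) (m : Fin N → Bool) :
    productLaw a m = ∏ i, coin (a i) (m i) := rfl

theorem indepLaw_eq_productLaw (b : unitInterval) (n : ℕ) :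
    indepLaw b n = productLaw fun _ => b := rfl

theorem sum_productLaw_mul_prod {N : ℕ} (a : Fin N → unitInterval) (f : Fin N → Bool → ℝ≥0∞) :
    ∑ m, productLaw a m * ∏ i, f i (m i) =
      ∏ i, (coin (a i) true * f i true + coin (a i) false * f i false) := by
  simp only [productLaw_apply, ← Finset.prod_mul_distrib]
  rw [← Fintype.prod_sum (fun i v => coin (a i) v * f i v)]
  simp

theorem sum_productLaw_mul_apply {N : ℕ} (a : Fin N → unitInterval) (y : Fin N)
    (f : Bool → ℝ≥0∞) :
    ∑ m, productLaw a m * f (m y) = coin (a y) true * f true + coin (a y) false * f false := by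
  have h := sum_productLaw_mul_prod a fun i v => if i = y then f v else 1
  simp only [Finset.prod_ite_eq', Finset.mem_univ, if_true] at h
  rw [h, Finset.prod_eq_single y]
  · simp
  · intro i _ hi
    simp [hi, coin_add]
  · simp

/-- The law of `productLaw fun _ => a` conditioned on the toss `x` being successful. -/
def plantedLaw {N : ℕ} (a : unitInterval) (x : Fin N) : PMF (Fin N → Bool) :=
  productLaw (Function.update (fun _ => a) x 1)

/-- Conditioning on an event of probability `a` multiplies no mass by more than `1 / a`. The product
form also covers `a = 0`. -/
theorem coin_mul_plantedLaw_le {N : ℕ} (a : unitInterval) (x : Fin N) (m : Fin N → Bool) :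
    coin a true * plantedLaw a x m ≤ productLaw (fun _ => a) m := by
  rw [plantedLaw, productLaw_apply, productLaw_apply,
    ← Finset.mul_prod_erase _ _ (Finset.mem_univ x),
    ← Finset.mul_prod_erase _ _ (Finset.mem_univ x), ← mul_assoc]
  refine mul_le_mul' ?_ (Finset.prod_le_prod' fun i hi => ?_)
  · cases m x <;> simp [coin]
  · rw [Function.update_of_ne (Finset.ne_of_mem_erase hi)]

namespace Protocol

variable {n : ℕ} {X M : Type}

/-! ### One-round protocols. -/

/-- The protocol in which every player sends exactly one message, in order. -/
def oneRound (n : ℕ) (ign : PMF M) (leak : X → PMF M) : Protocol n X M where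
  next t := if h : t.length < n then some ⟨⟨t.length, h⟩, ign, leak⟩ else none
  length := n
  next_eq_none t ht := by simp [ht]

theorem oneRound_next {ign : PMF M} {leak : X → PMF M} {t : List M} (h : t.length < n) :
    (oneRound n ign leak).next t = some ⟨⟨t.length, h⟩, ign, leak⟩ := by
  simp [oneRound, h]

/-- Given the knowledge of all players, the messages are independent, so multiplicative functionals
have product expectations. The default `1` is never reached, since `t₀.length + k = n`. -/
theorem tsum_run_oneRound (ign : PMF M) (leak : X → PMF M) (g : M → ℝ≥0∞) (x : X)
    (l : Fin n → Bool) (k : ℕ) (t₀ : List M) (hk : t₀.length + k = n) :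
    ∑' t, (oneRound n ign leak).run x l k t₀ t * (t.map g).prod =
      (t₀.map g).prod * ∏ j ∈ Finset.range k,
        if h : t₀.length + j < n then
          ∑' m, (if l ⟨t₀.length + j, h⟩ = true then leak x else ign) m * g m
        else 1 := by
  induction k generalizing t₀ with
  | zero =>
    rw [run, tsum_eq_single t₀]
    · simp
    · intro t ht
      simp [PMF.pure_apply, ht]
  | succ k ih =>
    have hlt : t₀.length < n := by omega
    rw [run, oneRound_next hlt]
    simp only [PMF.bind_apply, ← ENNReal.tsum_mul_right]
    rw [ENNReal.tsum_comm, Finset.prod_range_succ']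
    simp only [mul_assoc, ENNReal.tsum_mul_left]
    have h1 : ∀ m, ∑' t, (oneRound n ign leak).run x l k (t₀ ++ [m]) t * (t.map g).prod =
        g m * ((t₀.map g).prod * ∏ j ∈ Finset.range k,
          if h : t₀.length + (j + 1) < n then
            ∑' m, (if l ⟨t₀.length + (j + 1), h⟩ = true then leak x else ign) m * g m
          else 1) := by
      intro m
      rw [ih (t₀ ++ [m]) (by simp; omega)]
      simp only [List.map_append, List.map_cons, List.map_nil, List.prod_append, List.prod_cons,
        List.prod_nil, mul_one, List.length_append, List.length_cons, List.length_nil, zero_add,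
        add_assoc, add_comm 1]
      ring
    simp only [h1, ← mul_assoc, ENNReal.tsum_mul_right, add_zero, hlt, dif_pos]
    ring

theorem tsum_lawGiven_oneRound (ign : PMF M) (leak : X → PMF M) (b : unitInterval)
    (g : M → ℝ≥0∞) (x : X) :
    ∑' t, (oneRound n ign leak).lawGiven (indepLaw b n) x t * (t.map g).prod =
      (coin b true * ∑' m, leak x m * g m + coin b false * ∑' m, ign m * g m) ^ n := by
  have h := sum_productLaw_mul_prod (N := n) (fun _ => b) fun _ v =>
    ∑' m, (if v = true then leak x else ign) m * g m
  simp only [if_true, Bool.false_eq_true, if_false, Finset.prod_const, Finset.card_univ,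
    Fintype.card_fin] at h
  rw [← h, ← indepLaw_eq_productLaw]
  simp only [lawGiven_apply, Finset.sum_mul]
  rw [Summable.tsum_finsetSum fun _ _ => ENNReal.summable]
  refine Finset.sum_congr rfl fun l _ => ?_
  simp only [mul_assoc]
  rw [ENNReal.tsum_mul_left]
  congr 1
  have := tsum_run_oneRound ign leak g x l n [] (by simp)
  rw [show (oneRound n ign leak).transcriptLaw x l = (oneRound n ign leak).run x l n [] from rfl,
    this, ← Fin.prod_univ_eq_prod_range (fun j => if h : ([] : List M).length + j < n then
      ∑' m, (if l ⟨([] : List M).length + j, h⟩ = true then leak x else ign) m * g m else 1)]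
  simp

/-- The clause on players who have already spoken makes the induction work: each player speaks at
most once, so the likelihood-ratio bound is never compounded. For silent players it is just `α ≤ 1`.
-/
theorem exists_run_oneRound_eq_prod (ign : PMF M) (leak : X → PMF M) {α : ℝ} (hα : α ≤ 1)
    (hle : ∀ x m, α * (leak x m).toReal ≤ (ign m).toReal) (k : ℕ) (t₀ t : List M) :
    ∃ (e : ℝ) (q : Fin n → Option X → ℝ), 0 ≤ e ∧ (∀ i o, 0 ≤ q i o) ∧
      (∀ i : Fin n, (i : ℕ) < t₀.length → ∀ o, q i o = 1) ∧
      (∀ i x, α * q i (some x) ≤ q i none) ∧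
      ∀ x l, ((oneRound n ign leak).run x l k t₀ t).toReal =
        e * ∏ i, q i (knowledge x (l i)) := by
  classical
  induction k generalizing t₀ with
  | zero =>
    exact ⟨if t = t₀ then 1 else 0, fun _ _ => 1, by split_ifs <;> simp, by simp, by simp,
      fun _ _ => by simpa using hα, fun x l => by rw [run, PMF.pure_apply]; split_ifs <;> simp⟩
  | succ k ih =>
    by_cases hlt : t₀.length < n
    · have hs := oneRound_next (ign := ign) (leak := leak) hlt
      by_cases h : ∃ m, t₀ ++ [m] <+: t
      · obtain ⟨m, hm⟩ := h
        obtain ⟨e, q, he, hq, hq1, hqα, H⟩ := ih (t₀ ++ [m])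
        have hsp : ∀ o, q ⟨t₀.length, hlt⟩ o = 1 := fun o => hq1 _ (by simp) o
        refine ⟨e, fun i o => (if i = ⟨t₀.length, hlt⟩ then
            ((Step.mk (⟨t₀.length, hlt⟩ : Fin n) ign leak).messageLaw o m).toReal else 1) * q i o,
          he, fun i o => ?_, fun i hi o => ?_, fun i x => ?_, fun x l => ?_⟩
        · have := hq i o
          dsimp only
          split_ifs <;> positivity
        · have : i ≠ ⟨t₀.length, hlt⟩ := fun h => by simp [h] at hi
          simp [this, hq1 i (by simp; omega)]
        · dsimp only
          split_ifs with hi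
          · subst hi
            simpa [hsp, Step.messageLaw] using hle x m
          · simpa using hqα i x
        · rw [run_succ_of_prefix _ hs hm, ENNReal.toReal_mul, H, Finset.prod_mul_distrib,
            Finset.prod_ite_eq' Finset.univ, if_pos (Finset.mem_univ _)]
          ring
      · push Not at h
        exact ⟨0, fun _ _ => 1, le_rfl, by simp, by simp, fun _ _ => by simpa using hα, fun x l => by
          rw [run_succ_of_not_prefix _ hs h]; simp⟩
    · have hs : (oneRound n ign leak).next t₀ = none := by simp [oneRound, hlt]
      exact ⟨if t = t₀ then 1 else 0, fun _ _ => 1, by split_ifs <;> simp, by simp, by simp,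
        fun _ _ => by simpa using hα, fun x l => by
        rw [run, hs]; simp only [PMF.pure_apply]; split_ifs <;> simp⟩

/-- In terms of odds: `hbc` balances the prior odds against a likelihood ratio of at most `1 / α`,
so the posterior odds stay within `c / (1 - c)`. -/
theorem posterior_oneRound_le [Fintype X] [Nonempty X] (ign : PMF M) (leak : X → PMF M) {α c : ℝ}
    (hα : α ≤ 1) (hle : ∀ x m, α * (leak x m).toReal ≤ (ign m).toReal) (b : unitInterval)
    (hc : 0 ≤ c) (hbc : b * (1 - c) = c * (1 - b) * α) (i : Fin n) (t : List M) (x : X) :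
    (oneRound n ign leak).posterior (indepLaw b n) i t x ≤ c := by
  obtain ⟨e, q, he, hq, -, hqα, H⟩ :=
    exists_run_oneRound_eq_prod (n := n) ign leak hα hle n [] t
  have hb0 : 0 ≤ (b : ℝ) := b.2.1
  have hb1 : 0 ≤ 1 - (b : ℝ) := sub_nonneg.2 b.2.2
  rw [posterior_eq]
  refine div_le_of_le_mul₀ ENNReal.toReal_nonneg hc ?_
  rw [toReal_lawGiven_indepLaw _ b H, toReal_knowMass_indepLaw _ b H,
    ← Finset.mul_prod_erase _ _ (Finset.mem_univ i)]
  have h1 : b * q i (some x) ≤ c * (b * q i (some x) + (1 - b) * q i none) := by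
    have := mul_le_mul_of_nonneg_left (hqα i x) (mul_nonneg hc hb1)
    rw [← mul_assoc, ← hbc] at this
    linarith
  set Z := ∏ j ∈ Finset.univ.erase i, ((b : ℝ) * q j (some x) + (1 - b) * q j none)
  have hZ : 0 ≤ Z := Finset.prod_nonneg fun j _ =>
    add_nonneg (mul_nonneg hb0 (hq _ _)) (mul_nonneg hb1 (hq _ _))
  calc e * (b * q i (some x) * Z) = b * q i (some x) * (e * Z) := by ring
    _ ≤ c * (b * q i (some x) + (1 - b) * q i none) * (e * Z) := by gcongr
    _ = _ := by ring

end Protocol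

/-! ### Scores and decoding errors. -/

theorem prod_map_ofReal_exp {M : Type} (f : M → ℝ) (t : List M) :
    (t.map fun m => ENNReal.ofReal (Real.exp (f m))).prod =
      ENNReal.ofReal (Real.exp (t.map f).sum) := by
  induction t with
  | nil => simp
  | cons m t ih =>
    simp only [List.map_cons, List.prod_cons, List.sum_cons, ih]
    rw [Real.exp_add, ENNReal.ofReal_mul (Real.exp_pos _).le]

theorem toOuterMeasure_le_tsum_mul {α : Type} (p : PMF α) (A : Set α) (F : α → ℝ≥0∞)
    (h : ∀ a ∈ A, 1 ≤ F a) : p.toOuterMeasure A ≤ ∑' a, p a * F a := by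
  rw [PMF.toOuterMeasure_apply]
  refine ENNReal.tsum_le_tsum fun a => ?_
  by_cases ha : a ∈ A
  · rw [Set.indicator_of_mem ha]
    exact le_mul_of_one_le_right' (h a ha)
  · simp [ha]

theorem one_sub_le_prob_of_compl {α : Type} (p : PMF α) (A : Set α) {δ : ℝ} (hδ : 0 ≤ δ)
    (h : p.toOuterMeasure Aᶜ ≤ ENNReal.ofReal δ) : 1 - δ ≤ prob p A := by
  have h1 : (1 : ℝ≥0∞) ≤ p.toOuterMeasure A + ENNReal.ofReal δ := by
    have hu : p.toOuterMeasure Set.univ = 1 :=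
      (PMF.toOuterMeasure_apply_eq_one_iff p _).2 (Set.subset_univ _)
    rw [← hu, ← Set.union_compl_self A]
    exact (MeasureTheory.measure_union_le _ _).trans (by gcongr)
  have hfin : p.toOuterMeasure A ≠ ⊤ := by
    refine ne_top_of_le_ne_top ENNReal.one_ne_top ?_
    rw [← (PMF.toOuterMeasure_apply_eq_one_iff p Set.univ).2 (Set.subset_univ _)]
    exact MeasureTheory.measure_mono (Set.subset_univ _)
  have h2 := ENNReal.toReal_mono (ENNReal.add_ne_top.2 ⟨hfin, ENNReal.ofReal_ne_top⟩) h1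
  rw [ENNReal.toReal_add hfin ENNReal.ofReal_ne_top, ENNReal.toReal_one,
    ENNReal.toReal_ofReal hδ] at h2
  rw [prob]
  linarith

/-- The score of the candidate secret `x` after the messages `t`. -/
def score {N : ℕ} (w : Bool → ℝ) (t : List (Fin N → Bool)) (x : Fin N) : ℝ :=
  (t.map fun m => w (m x)).sum

/-- The players send coin tosses, one for each candidate secret; those who know the secret make
sure that its toss is successful. -/
def tossProtocol (n N : ℕ) (a : unitInterval) : Protocol n (Fin N) (Fin N → Bool) :=
  Protocol.oneRound n (productLaw fun _ => a) (plantedLaw a)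

theorem tsum_tossProtocol_self (n : ℕ) {N : ℕ} (a b : unitInterval) (x : Fin N) (f : Bool → ℝ) :
    ∑' t, (tossProtocol n N a).lawGiven (indepLaw b n) x t *
      ENNReal.ofReal (Real.exp (score f t x)) =
    ENNReal.ofReal ((b + (1 - b) * a) * Real.exp (f true) +
      (1 - b) * (1 - a) * Real.exp (f false)) ^ n := by
  have ha0 : 0 ≤ (a : ℝ) := a.2.1
  have ha1 : 0 ≤ 1 - (a : ℝ) := sub_nonneg.2 a.2.2
  have hb0 : 0 ≤ (b : ℝ) := b.2.1
  have hb1 : 0 ≤ 1 - (b : ℝ) := sub_nonneg.2 b.2.2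
  simp only [score, ← prod_map_ofReal_exp]
  rw [tossProtocol, Protocol.tsum_lawGiven_oneRound, tsum_fintype, tsum_fintype, plantedLaw,
    sum_productLaw_mul_apply _ x fun v => ENNReal.ofReal (Real.exp (f v)),
    sum_productLaw_mul_apply _ x fun v => ENNReal.ofReal (Real.exp (f v))]
  congr 1
  simp only [Function.update_self, coin, if_true, Bool.false_eq_true, if_false]
  simp only [Set.Icc.coe_one, ENNReal.ofReal_one, sub_self, ENNReal.ofReal_zero, one_mul, zero_mul,
    add_zero]
  rw [← ENNReal.ofReal_mul ha0, ← ENNReal.ofReal_mul ha1, ← ENNReal.ofReal_add (by positivity)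
    (by positivity), ← ENNReal.ofReal_mul hb0, ← ENNReal.ofReal_mul hb1,
    ← ENNReal.ofReal_add (by positivity) (by positivity)]
  congr 1
  ring

/-- The toss for a wrong candidate has bias `a` whether or not the sender is informed, so `b` drops
out. -/
theorem tsum_tossProtocol_of_ne (n : ℕ) {N : ℕ} (a b : unitInterval) {x y : Fin N} (hxy : y ≠ x)
    (f : Bool → ℝ) :
    ∑' t, (tossProtocol n N a).lawGiven (indepLaw b n) x t *
      ENNReal.ofReal (Real.exp (score f t y)) =
    ENNReal.ofReal (a * Real.exp (f true) + (1 - a) * Real.exp (f false)) ^ n := by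
  have ha0 : 0 ≤ (a : ℝ) := a.2.1
  have ha1 : 0 ≤ 1 - (a : ℝ) := sub_nonneg.2 a.2.2
  simp only [score, ← prod_map_ofReal_exp]
  rw [tossProtocol, Protocol.tsum_lawGiven_oneRound, tsum_fintype, tsum_fintype, plantedLaw,
    sum_productLaw_mul_apply _ y fun v => ENNReal.ofReal (Real.exp (f v)),
    sum_productLaw_mul_apply _ y fun v => ENNReal.ofReal (Real.exp (f v)),
    Function.update_of_ne hxy, ← add_mul, coin_add, one_mul]
  congr 1
  simp only [coin, if_true, Bool.false_eq_true, if_false]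
  rw [← ENNReal.ofReal_mul ha0, ← ENNReal.ofReal_mul ha1, ← ENNReal.ofReal_add (by positivity)
    (by positivity)]

/-- A Chernoff bound with parameter `-s` controls a negative score of the true secret; one with
parameter `1` and a union bound control the wrong candidates. -/
theorem one_sub_le_prob_tossProtocol (n : ℕ) {N : ℕ} (a b : unitInterval) (x : Fin N)
    (w : Bool → ℝ) {s ρ σ : ℝ} (hs : 0 ≤ s) (hσ0 : 0 ≤ σ)
    (hρ : (b + (1 - b) * a) * Real.exp (-s * w true) +
      (1 - b) * (1 - a) * Real.exp (-s * w false) = ρ)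
    (hσ : a * Real.exp (w true) + (1 - a) * Real.exp (w false) = σ) :
    1 - (ρ ^ n + N * σ ^ n) ≤ prob ((tossProtocol n N a).lawGiven (indepLaw b n) x)
      {t | 0 ≤ score w t x ∧ ∀ y ≠ x, score w t y < 0} := by
  have ha0 : 0 ≤ (a : ℝ) := a.2.1
  have ha1 : 0 ≤ 1 - (a : ℝ) := sub_nonneg.2 a.2.2
  have hb0 : 0 ≤ (b : ℝ) := b.2.1
  have hb1 : 0 ≤ 1 - (b : ℝ) := sub_nonneg.2 b.2.2
  have hρ0 : 0 ≤ ρ := by rw [← hρ]; positivity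
  refine one_sub_le_prob_of_compl _ _ (by positivity) ?_
  have hscore : ∀ t, score (fun v => -s * w v) t x = -s * score w t x := fun t => by
    simp only [score, List.sum_map_mul_left]
  refine (toOuterMeasure_le_tsum_mul _ _ (fun t =>
    ENNReal.ofReal (Real.exp (score (fun v => -s * w v) t x)) +
      ∑ y ∈ Finset.univ.erase x, ENNReal.ofReal (Real.exp (score w t y))) ?_).trans ?_
  · intro t ht
    by_cases h0 : 0 ≤ score w t x
    · have : ∃ y, y ≠ x ∧ 0 ≤ score w t y := by
        by_contra! h
        exact ht ⟨h0, h⟩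
      obtain ⟨y, hy, hy0⟩ := this
      refine le_add_left (le_trans ?_ (Finset.single_le_sum
        (f := fun y => ENNReal.ofReal (Real.exp (score w t y))) (fun _ _ => zero_le)
        (Finset.mem_erase.2 ⟨hy, Finset.mem_univ y⟩)))
      simpa using hy0
    · refine le_add_right ?_
      rw [hscore, ENNReal.one_le_ofReal, Real.one_le_exp_iff]
      nlinarith
  · simp only [mul_add, Finset.mul_sum]
    rw [ENNReal.tsum_add, Summable.tsum_finsetSum fun _ _ => ENNReal.summable,
      tsum_tossProtocol_self, hρ, Finset.sum_congr rfl fun y hy =>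
        tsum_tossProtocol_of_ne n a b (Finset.ne_of_mem_erase hy) w, hσ, Finset.sum_const,
      nsmul_eq_mul, ENNReal.ofReal_add (by positivity) (by positivity),
      ENNReal.ofReal_mul (by positivity), ENNReal.ofReal_pow hρ0, ENNReal.ofReal_pow hσ0,
      ENNReal.ofReal_natCast]
    gcongr
    exact (Finset.card_le_univ _).trans_eq (Fintype.card_fin N)

/-! ### Safety of the toss protocol. -/

theorem toReal_coin_true (a : unitInterval) : (coin a true).toReal = a := by
  simp [coin, ENNReal.toReal_ofReal a.2.1]

theorem posterior_tossProtocol_le (n : ℕ) {N : ℕ} [Nonempty (Fin N)] (a b : unitInterval) {c : ℝ}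
    (hc : 0 ≤ c) (hbc : b * (1 - c) = c * (1 - b) * a) (i : Fin n) (t : List (Fin N → Bool))
    (x : Fin N) : (tossProtocol n N a).posterior (indepLaw b n) i t x ≤ c := by
  refine Protocol.posterior_oneRound_le _ _ a.2.2 (fun x m => ?_) b hc hbc i t x
  rw [← toReal_coin_true, ← ENNReal.toReal_mul]
  exact ENNReal.toReal_mono (PMF.apply_ne_top _ _) (coin_mul_plantedLaw_le a x m)

/-- The bias is the ratio of the prior odds to the largest allowed odds; it is at most `1` exactly
because `b ≤ c`. -/
theorem exists_toss_bias (b : unitInterval) {c : ℝ} (hbc : (b : ℝ) ≤ c) (hc0 : 0 < c)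
    (hc1 : c < 1) : ∃ a : unitInterval, b * (1 - c) = c * (1 - b) * (a : ℝ) := by
  have hb0 : 0 ≤ (b : ℝ) := b.2.1
  have hb1 : 0 < 1 - (b : ℝ) := by linarith
  have hc : 0 < 1 - c := by linarith
  refine ⟨⟨b * (1 - c) / (c * (1 - b)), by positivity, ?_⟩, ?_⟩
  · rw [div_le_one (by positivity)]
    nlinarith
  · field_simp

theorem isSafe_tossProtocol (n : ℕ) (h : ℝ) (a b : unitInterval) {c ε : ℝ} (hc : 0 ≤ c)
    (hbc : b * (1 - c) = c * (1 - b) * a) (D : List (Secret h → Bool) → Secret h)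
    (hD : ∀ x, 1 - ε ≤ prob ((tossProtocol n (2 ^ ⌈h⌉₊) a).lawGiven (indepLaw b n) x)
      {t | D t = x}) :
    IsSafe h (indepLaw b n) c ε (tossProtocol n (2 ^ ⌈h⌉₊) a) D := by
  refine ⟨fun x => (hD x).trans_eq ?_, fun i t x _ => posterior_tossProtocol_le n a b hc hbc i t x⟩
  rw [← Protocol.condProb_joint_transcript]
  congr 1
  ext ω
  exact ⟨fun hω => ⟨fun i => posterior_tossProtocol_le n a b hc hbc i _ x, hω⟩, fun hω => hω.2⟩

/-! ### Achievable rates and the capacity. -/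

/-- At rate zero there is a single secret and nothing to decode. This rate needs its own argument
because the capacity may be zero, with no nonnegative rate strictly below it. -/
theorem safelyAchievable_zero (b : unitInterval) {c : ℝ} (hbc : (b : ℝ) ≤ c) (hc0 : 0 < c)
    (hc1 : c < 1) : SafelyAchievable b c 0 := by
  obtain ⟨a, ha⟩ := exists_toss_bias b hbc hc0 hc1
  refine ⟨le_rfl, fun ε hε n₀ => ⟨n₀, le_rfl, _, tossProtocol n₀ _ a, fun _ => 0,
    isSafe_tossProtocol n₀ _ a b hc0.le ha _ fun x => ?_⟩⟩
  refine one_sub_le_prob_of_compl _ _ hε.le ?_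
  have hsub : Subsingleton (Secret (n₀ * 0)) := by
    rw [Secret, mul_zero, Nat.ceil_zero, pow_zero]
    infer_instance
  have : ({t | (fun _ => 0 : List (Secret (n₀ * 0) → Bool) → Secret (n₀ * 0)) t = x} :
      Set (List (Secret (n₀ * 0) → Bool)))ᶜ = ∅ := by
    ext t
    simp [Subsingleton.elim x 0]
  rw [this]
  simp

/-- If a random variable with two values has positive mean, its Laplace transform is less than `1`
at some positive point. -/
theorem exists_laplace_lt_one {p u v : ℝ} (h : 0 < p * u + (1 - p) * v) :
    ∃ s : ℝ, 0 < s ∧ p * Real.exp (-s * u) + (1 - p) * Real.exp (-s * v) < 1 := by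
  have hd : ∀ r : ℝ, HasDerivAt (fun s : ℝ => Real.exp (-s * r)) (-r) 0 := fun r => by
    have h := (((hasDerivAt_id (0 : ℝ)).neg.mul_const r)).exp
    simpa using h
  have hφ := ((hd u).const_mul p).add ((hd v).const_mul (1 - p))
  -- The transform equals `1` at `0`, with derivative minus the mean, hence negative.
  have hlt := hφ.tendsto_slope_zero_right.eventually_lt_const (u := 0) (by linarith)
  obtain ⟨s, hs, hs0⟩ := (hlt.and self_mem_nhdsWithin).exists
  refine ⟨s, hs0, ?_⟩
  have hs0' : 0 < s := hs0
  have h1 := neg_of_mul_neg_right (a := s⁻¹) (by simpa using hs) (inv_pos.2 hs0').le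
  simp only [neg_mul]
  linarith

open Filter Topology in
theorem safelyAchievable_of_lt (b : unitInterval) {c R : ℝ} (hbc : (b : ℝ) ≤ c) (hc0 : 0 < c)
    (hc1 : c < 1) (hR0 : 0 ≤ R)
    (hR : R < (-(b : ℝ) * Real.logb 2 (1 - c) + c * Real.logb 2 (1 - (b : ℝ))) / c) :
    SafelyAchievable b c R := by
  obtain ⟨a, ha⟩ := exists_toss_bias b hbc hc0 hc1
  have hlog2 : 0 < Real.log 2 := Real.log_pos one_lt_two
  have hb1 : 0 < 1 - (b : ℝ) := by linarith
  have hc : 0 < 1 - c := by linarith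
  have hC : (-(b : ℝ) * Real.logb 2 (1 - c) + c * Real.logb 2 (1 - (b : ℝ))) / c =
      (Real.log (1 - b) - b / c * Real.log (1 - c)) / Real.log 2 := by
    simp only [Real.logb]; field_simp; ring
  rw [hC, lt_div_iff₀ hlog2] at hR
  -- `γ` is the decoding threshold per message, strictly between the rate and the capacity in nats;
  -- both error exponents come from these gaps.
  obtain ⟨γ, hγR, hγC⟩ := exists_between hR
  have ha' : (b : ℝ) + (1 - b) * a = b / c := by
    rw [eq_div_iff hc0.ne']; linarith
  have ha'' : (1 - b) * (1 - a) = 1 - (b : ℝ) / c := by rw [← ha']; ring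
  -- `u` and `v` are the log-likelihood ratios of a successful and a failed toss, between bias `b /
  -- c` (true secret) and bias `a` (wrong candidate). Their mean under bias `b / c` is the capacity
  -- in nats.
  set u := Real.log (1 - b) - Real.log (1 - c) with hu
  set v := Real.log (1 - (b : ℝ)) with hv
  obtain ⟨s, hs, hρ⟩ := exists_laplace_lt_one (p := b / c) (u := u - γ) (v := v - γ)
    (by rw [hu]; linarith)
  set ρ := (b : ℝ) / c * Real.exp (-s * (u - γ)) + (1 - b / c) * Real.exp (-s * (v - γ)) with hρdef
  have hρ0 : 0 ≤ ρ := by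
    have h1 : 0 ≤ (b : ℝ) / c := div_nonneg b.2.1 hc0.le
    have h2 : 0 ≤ 1 - (b : ℝ) / c := sub_nonneg.2 ((div_le_one hc0).2 hbc)
    positivity
  have hσ : a * Real.exp (u - γ) + (1 - a) * Real.exp (v - γ) = Real.exp (-γ) := by
    -- A likelihood ratio has mean one under the law in its denominator.
    have h1 : (a : ℝ) * Real.exp u + (1 - a) * Real.exp v = 1 := by
      rw [hu, Real.exp_sub, hv, Real.exp_log hb1, Real.exp_log hc]
      field_simp
      linarith
    rw [sub_eq_add_neg u, sub_eq_add_neg v, Real.exp_add, Real.exp_add]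
    linear_combination Real.exp (-γ) * h1
  set τ := Real.exp (R * Real.log 2 - γ) with hτ
  have hτ1 : τ < 1 := by rw [hτ, Real.exp_lt_one_iff]; linarith
  have hlim : Tendsto (fun n : ℕ => ρ ^ n + 2 * τ ^ n) atTop (𝓝 0) := by
    have := (tendsto_pow_atTop_nhds_zero_of_lt_one hρ0 hρ).add
      ((tendsto_pow_atTop_nhds_zero_of_lt_one (Real.exp_pos _).le hτ1).const_mul 2)
    simpa using this
  refine ⟨hR0, fun ε hε n₀ => ?_⟩
  obtain ⟨n, hn, hnn₀⟩ := ((hlim.eventually_le_const hε).and (eventually_ge_atTop n₀)).exists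
  set w : Bool → ℝ := fun z => if z = true then u - γ else v - γ
  refine ⟨n, hnn₀, _, tossProtocol n _ a, fun t => Classical.epsilon fun y => 0 ≤ score w t y,
    isSafe_tossProtocol n _ a b hc0.le ha _ fun x => ?_⟩
  have h := one_sub_le_prob_tossProtocol n a b x w (s := s) (ρ := ρ) hs.le (Real.exp_pos _).le
    (by simp [w, ha', ha'', hρdef]) (by simpa [w] using hσ)
  refine le_trans ?_ (h.trans ?_)
  · have hN : ((2 ^ ⌈n * R⌉₊ : ℕ) : ℝ) * Real.exp (-γ) ^ n ≤ 2 * τ ^ n := by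
      -- The factor `2` pays for rounding `n * R` up.
      have h1 : ((2 ^ ⌈n * R⌉₊ : ℕ) : ℝ) ≤ 2 * Real.exp (R * Real.log 2) ^ n := by
        rw [Nat.cast_pow, Nat.cast_two, ← Real.rpow_natCast, Real.rpow_def_of_pos two_pos,
          ← Real.exp_nat_mul]
        nth_rewrite 2 [← Real.exp_log (two_pos : (0 : ℝ) < 2)]
        rw [← Real.exp_add, Real.exp_le_exp]
        have := (Nat.ceil_lt_add_one (mul_nonneg n.cast_nonneg hR0)).le
        nlinarith
      calc _ ≤ 2 * Real.exp (R * Real.log 2) ^ n * Real.exp (-γ) ^ n := by gcongr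
        _ = 2 * τ ^ n := by rw [mul_assoc, ← mul_pow, ← Real.exp_add, hτ, sub_eq_add_neg]
    linarith
  · refine ENNReal.toReal_mono (ne_top_of_le_ne_top ENNReal.one_ne_top ?_)
      (MeasureTheory.measure_mono ?_)
    · rw [← (PMF.toOuterMeasure_apply_eq_one_iff _ Set.univ).2 (Set.subset_univ _)]
      exact MeasureTheory.measure_mono (Set.subset_univ _)
    · intro t ht
      have hspec := Classical.epsilon_spec (p := fun y => 0 ≤ score w t y) ⟨x, ht.1⟩
      by_contra hne
      exact absurd hspec (not_le.2 (ht.2 _ hne))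

theorem SafelyAchievable.riskilyAchievable {b : unitInterval} {c R : ℝ}
    (h : SafelyAchievable b c R) : RiskilyAchievable b c R := by
  refine ⟨h.1, fun ε hε n₀ => ?_⟩
  obtain ⟨n, hn, M, π, D, hπ⟩ := h.2 ε hε n₀
  exact ⟨n, hn, M, π, D, hπ.1⟩

theorem capacity_le_of_mem_upperBounds (b : unitInterval) {c B : ℝ} (hbc : (b : ℝ) ≤ c)
    (hc0 : 0 < c) (hc1 : c < 1) (hB : B ∈ upperBounds {R : ℝ | SafelyAchievable b c R}) :
    (-(b : ℝ) * Real.logb 2 (1 - c) + c * Real.logb 2 (1 - (b : ℝ))) / c ≤ B := by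
  refine le_of_forall_lt_imp_le_of_dense fun R hR => ?_
  rcases le_or_gt 0 R with h0 | h0
  -- Negative `R` are not rates; they are handled by comparison with the achievable rate zero.
  · exact hB (safelyAchievable_of_lt b hbc hc0 hc1 h0 hR)
  · exact h0.le.trans (hB (safelyAchievable_zero b hbc hc0 hc1))

end Cryptogenography

end

theorem mainTheorem2 (b : unitInterval) (c : ℝ) (hbc : (b : ℝ) ≤ c) (hc0 : 0 < c) (hc1 : c < 1) :
    Cryptogenography.IsSafeCapacity b c
      ((-(b : ℝ) * Real.logb 2 (1 - c) + c * Real.logb 2 (1 - (b : ℝ))) / c) ∧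
    Cryptogenography.IsRiskyCapacity b c
      ((-(b : ℝ) * Real.logb 2 (1 - c) + c * Real.logb 2 (1 - (b : ℝ))) / c) := by
  refine ⟨⟨fun R hR => ?_, fun B hB => ?_⟩, ⟨fun R hR => ?_, fun B hB => ?_⟩⟩
  · exact Cryptogenography.rate_le_of_riskilyAchievable b hbc hc0 hc1
      (Cryptogenography.SafelyAchievable.riskilyAchievable hR)
  · exact Cryptogenography.capacity_le_of_mem_upperBounds b hbc hc0 hc1 hB
  · exact Cryptogenography.rate_le_of_riskilyAchievable b hbc hc0 hc1 hR
  · exact Cryptogenography.capacity_le_of_mem_upperBounds b hbc hc0 hc1 fun R hR =>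
      hB (Cryptogenography.SafelyAchievable.riskilyAchievable hR)
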